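/- Let $\mathcal S,\mathcal A$ be finite sets, $P(\cdot\mid s,a)$ a transition kernel on $\mathcal S$, $\rho$ an initial state distribution and $\gamma\in[0,1)$. Let $\Pi$ be the set of policies $\pi=(\pi(\cdot\mid s))_{s}$ with $\pi(\cdot\mid s)\in\Delta_{\mathcal A}$ for every $s$, viewed as vectors in $\mathbb R^{\mathcal S\times\mathcal A}$ with the Euclidean norm. For $\pi\in\Pi$ let $$\mu^\pi(s,a)=\sum_{s_0}\rho(s_0)\sum_{\tau\ge0}\gamma^\tau\Pr{}^{\pi}[s_\tau=s,a_\tau=a\mid s_0]$$ be the unnormalized discounted occupancy measure, $d^\pi(s)=(1-\gamma)\sum_a\mu^\pi(s,a)$ the normalized state visitation distribution, and for $r\in\mathbb R^{\mathcal S\times\mathcal A}$ let $Q^\pi_r(s,a)=\mathbb E\big[\sum_{\tau\ge0}\gamma^\tau r(s_\tau,a_\tau)\mid s_0=s,a_0=a\big]$. Let $$\mathcal K=\Big\{\mu\in\mathbb R_{\ge0}^{\mathcal S\times\mathcal A}:\ \sum_{a'}\mu(s',a')=\rho(s')+\gamma\sum_{s,a}P(s'\mid s,a)\mu(s,a)\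 \ \forall s'\Big\}$$ be the set of feasible occupancy measures. Let $F:\mathcal K\to\mathbb R$ be concave, with gradient (relative to $\mathcal K$) $\Gamma(\pi)\in\mathbb R^{\mathcal S\times\mathcal A}$ at $\mu^\pi$ for every $\pi\in\Pi$, and put $G(\pi)=F(\mu^\pi)$. Assume 1. (exploration) $\rho(s)\ge\rho_{\min}>0$ for all $s$; 2. (bounded pseudo-rewards) there is $U$ with $\Gamma(\pi)(s,a)\in[0,U]$ for all $\pi\in\Pi$ and all $(s,a)$; 3. (smoothness) for some $L>0$, $G$ is $L$-smooth on $\Pi$: $G$ is differentiable along $\Pi$ and $|G(\pi)-G(\pi')-\langle\nabla G(\pi'),\pi-\pi'\rangle|\le\frac L2\|\pi-\pi'\|_2^2$ for all $\pi,\pi'\in\Pi$. Let $\eta=\rho_{\min}/L$. Let $(\pi_k)_{k\ge k_0}$, numbered from $k_0\in\{0,1\}$, start at an arbitrary policy $\pi_{k_0}\in\Pi$ and be generated by projected Q-ascent, either in the statewise form $$\pi_{k+1}(\cdot\mid s)=\mathrm{Proj}_{\Delta_{\mathcal A}}\big[\pi_k(\cdot\mid s)+\eta\,Q^{\pi_k}_{\Gamma(\pi_k)}(s,\cdot)\big]\quad\forall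 s,$$ or in the form $$\pi_{k+1}\in\arg\max_{\pi\in\Pi}\Big[\sum_s\frac{d^{\pi_k}(s)}{1-\gamma}\big\langle Q^{\pi_k}_{\Gamma(\pi_k)}(s,\cdot),\pi(\cdot\mid s)-\pi_k(\cdot\mid s)\big\rangle-\frac1{2\eta}\sum_s\frac{d^{\pi_k}(s)}{1-\gamma}\|\pi(\cdot\mid s)-\pi_k(\cdot\mid s)\|_2^2\Big].$$ Then $G$ attains its maximum over $\Pi$ at some $\pi^*$, and for every integer $K>k_0$ (that is, after at least one update) $$G(\pi^*)-G(\pi_K)\le\frac{32\,L\left(1+\frac1{(1-\gamma)\rho_{\min}}\right)}{(1-\gamma)^2\,\rho_{\min}\,K},$$ an $O(1/K)$ last-iterate rate. -/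

import Mathlib

namespace PQA

/-- A finite discounted Markov decision process (without rewards): transition kernel,
initial state distribution and discount factor. -/
structure MDP (S A : Type*) [Fintype S] where
  /-- `P s a s'` is the probability of moving from `s` to `s'` under the action `a`. -/
  P : S → A → S → ℝ
  P_mem : ∀ s a, P s a ∈ stdSimplex ℝ S
  ρ : S → ℝ
  ρ_mem : ρ ∈ stdSimplex ℝ S
  γ : ℝ
  γ_nonneg : 0 ≤ γ
  γ_lt_one : γ < 1

/-- `L`-smoothness of `G` on a set `s`: `G` is differentiable along `s` and
`|G x - G y - ⟨∇G y, x - y⟩| ≤ (L / 2) ‖x - y‖²` for all `x, y ∈ s`. -/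
def SmoothOnWith {E : Type*} [NormedAddCommGroup E] [InnerProductSpace ℝ E] [CompleteSpace E]
    (L : ℝ) (G : E → ℝ) (s : Set E) : Prop :=
  DifferentiableOn ℝ G s ∧
    ∀ x ∈ s, ∀ y ∈ s,
      |G x - G y - inner ℝ (gradientWithin G s y) (x - y)| ≤ L / 2 * ‖x - y‖ ^ 2

/-- The probability simplex over `A`, inside Euclidean space. -/
def simplex (A : Type*) [Fintype A] : Set (EuclideanSpace ℝ A) :=
  {p | (fun a => p a) ∈ stdSimplex ℝ A}

/-- The row `π(· | s)` of a table `π`. -/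
def row {S A : Type*} (π : EuclideanSpace ℝ (S × A)) (s : S) : EuclideanSpace ℝ A :=
  WithLp.toLp 2 fun a => π (s, a)

/-- The set `Π` of (tabular, stationary, stochastic) policies; `π (s, a)` is `π(a | s)`. -/
def policies (S A : Type*) [Fintype A] : Set (EuclideanSpace ℝ (S × A)) :=
  {π | ∀ s, row π s ∈ simplex A}

namespace MDP

variable {S A : Type*} [Fintype S] [Fintype A] [DecidableEq S] [DecidableEq A]

/-- The law of `(s_τ, a_τ)` when `(s_0, a_0)` has law `ν`, `s_{τ+1} ∼ P(· | s_τ, a_τ)` and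
`a_{τ+1} ∼ π(· | s_{τ+1})`. -/
def law (M : MDP S A) (π : EuclideanSpace ℝ (S × A)) (ν : S × A → ℝ) : ℕ → S × A → ℝ
  | 0 => ν
  | τ + 1 => fun x => (∑ y : S × A, M.law π ν τ y * M.P y.1 y.2 x.1) * π x

/-- The law of `(s_0, a_0)` when the chain starts in the state `s₀` and `a_0 ∼ π(· | s₀)`. -/
def startAt (π : EuclideanSpace ℝ (S × A)) (s₀ : S) : S × A → ℝ :=
  fun x => if x.1 = s₀ then π x else 0

/-- The unnormalised discounted state-action occupancy measure
`μ^π(s, a) = ∑_{s₀} ρ(s₀) ∑_τ γ^τ Pr^π[s_τ = s, a_τ = a | s₀]`. -/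
noncomputable def occupancy (M : MDP S A) (π : EuclideanSpace ℝ (S × A)) :
    EuclideanSpace ℝ (S × A) :=
  WithLp.toLp 2 fun x => ∑ s₀, M.ρ s₀ * ∑' τ : ℕ, M.γ ^ τ * M.law π (startAt π s₀) τ x

/-- The normalised discounted state visitation distribution
`d^π(s) = (1 - γ) ∑_a μ^π(s, a)`. -/
noncomputable def visitation (M : MDP S A) (π : EuclideanSpace ℝ (S × A)) (s : S) : ℝ :=
  (1 - M.γ) * ∑ a, M.occupancy π (s, a)

/-- The set `𝒦` of feasible occupancy measures: nonnegative tables satisfying the Bellman flow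
constraints. (Their total mass is then `1 / (1 - γ)`.) -/
def occupancySet (M : MDP S A) : Set (EuclideanSpace ℝ (S × A)) :=
  {μ | (∀ x, 0 ≤ μ x) ∧
    ∀ s', ∑ a', μ (s', a') = M.ρ s' + M.γ * ∑ s, ∑ a, M.P s a s' * μ (s, a)}

/-- The state-action value function of `π` for the reward `r`:
`Q^π_r(s, a) = E[∑_τ γ^τ r(s_τ, a_τ) | s_0 = s, a_0 = a]`. -/
noncomputable def Q (M : MDP S A) (π r : EuclideanSpace ℝ (S × A)) (s : S) (a : A) : ℝ :=
  ∑' τ : ℕ, M.γ ^ τ * ∑ x : S × A, M.law π (Pi.single (s, a) 1) τ x * r x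

/-- The vector `Q^π_r(s, ·)`. -/
noncomputable def Qrow (M : MDP S A) (π r : EuclideanSpace ℝ (S × A)) (s : S) :
    EuclideanSpace ℝ A :=
  WithLp.toLp 2 fun a => M.Q π r s a

/-- One step `π ↦ π'` of projected Q-ascent with pseudo-reward `r` and step size `η`, statewise
form: for every `s`, `π'(· | s)` is the Euclidean projection of `π(· | s) + η Q^π_r(s, ·)` onto
the simplex. -/
def IsProjStep (M : MDP S A) (η : ℝ) (r π π' : EuclideanSpace ℝ (S × A)) : Prop :=
  ∀ s, row π' s ∈ simplex A ∧
    IsMinOn (fun p => ‖p - (row π s + η • M.Qrow π r s)‖) (simplex A) (row π' s)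

/-- The objective that a step of projected Q-ascent from `π` maximises over all policies `π'`. -/
noncomputable def stepObjective (M : MDP S A) (η : ℝ) (r π π' : EuclideanSpace ℝ (S × A)) : ℝ :=
  ∑ s, M.visitation π s / (1 - M.γ) * inner ℝ (M.Qrow π r s) (row π' s - row π s) -
    1 / (2 * η) * ∑ s, M.visitation π s / (1 - M.γ) * ‖row π' s - row π s‖ ^ 2

/-- One step `π ↦ π'` of projected Q-ascent with pseudo-reward `r` and step size `η`, as the
maximisation of `stepObjective` over all policies. -/
def IsArgmaxStep (M : MDP S A) (η : ℝ) (r π π' : EuclideanSpace ℝ (S × A)) : Prop :=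
  π' ∈ policies S A ∧ IsMaxOn (M.stepObjective η r π) (policies S A) π'

/-- The objective `G(π) = F(μ^π)` of a general utility `F`. -/
noncomputable def utility (M : MDP S A) (F : EuclideanSpace ℝ (S × A) → ℝ)
    (π : EuclideanSpace ℝ (S × A)) : ℝ :=
  F (M.occupancy π)

end MDP

end PQA

/-!
The last-iterate rate rests on one inequality per step. Write `w^π(s) = ∑_a μ^π(s, a)` for the
state occupancy, `δ` for the gap `G(π*) - G(π)` and `Q` for the state-action values under the
pseudo-reward `Γ(π)`.

The flow constraints and the Bellman equation for `Q` give the performance difference identity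
`⟨r, μ^p - μ^π⟩ = ∑ₛ w^p(s) ⟨Q(s, ·), p(s, ·) - π(s, ·)⟩` (`MDP.inner_occupancy_sub`). It is used
twice. Along a segment of policies it yields the policy gradient, which is the same sum with `w^π`
in place of `w^p` (`MDP.inner_gradientWithin_utility`); together with concavity of `F` it bounds
`δ` by the sum with weights `w^{π*}` (`MDP.utility_sub_le_advantage`).

Since `w^π ≥ ρmin`, the step size `ρmin / L` makes the proximal term of a step dominate the
smoothness error, so that a step raises `G` by at least the value of the step objective at every
policy (`MDP.IsArgmaxStep.utility_add_stepObjective_le`). The statewise projections maximise the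
same objective, whence the two forms of the method are treated at once
(`MDP.IsProjStep.isArgmaxStep`). Two comparison policies are inserted:

* `π*` itself: smoothness bounds its objective below by `δ` minus a quadratic term, so the gap after
  any step is at most `2 C c`, with `c = (1 - γ) ρmin` and `C = L / c ^ 2`, however large it was
  before (`MDP.IsArgmaxStep.utility_sub_le`);
* the mixture which in the state `s` moves the fraction `α w^{π*}(s) / w^π(s)` of the way to `π*`:
  the fractions change the weights `w^π` into `w^{π*}`, so the new gap is at most
  `δ - α δ + α ^ 2 C` for `0 ≤ α ≤ c` (`MDP.IsArgmaxStep.utility_sub_le_recursion`).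

The first bound makes `α = δ / (2 C)` admissible from the first update on. This gives the recursion
`δ' ≤ δ - δ ^ 2 / (4 C)` and hence `δ ≤ 8 C / K` (`le_div_of_quadratic_decrease`), which is smaller
than the claimed bound.
-/

namespace PQA

/-! ### The set of policies -/

section Policies

variable {S A : Type*}

lemma row_sub (π π' : EuclideanSpace ℝ (S × A)) (s : S) :
    row (π - π') s = row π s - row π' s := rfl

lemma row_smul (c : ℝ) (π : EuclideanSpace ℝ (S × A)) (s : S) :
    row (c • π) s = c • row π s := rfl

/-- Moving in each state `s` a fraction `β s` of the way from `π` to `p`. -/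
noncomputable def statewiseMix (β : S → ℝ) (π p : EuclideanSpace ℝ (S × A)) :
    EuclideanSpace ℝ (S × A) :=
  WithLp.toLp 2 fun x => π x + β x.1 * (p x - π x)

lemma row_statewiseMix (β : S → ℝ) (π p : EuclideanSpace ℝ (S × A)) (s : S) :
    row (statewiseMix β π p) s = row π s + β s • (row p s - row π s) := rfl

variable [Fintype A]

lemma nonneg_of_mem_policies {π : EuclideanSpace ℝ (S × A)} (h : π ∈ policies S A) (x : S × A) :
    0 ≤ π x :=
  (h x.1).1 x.2

lemma sum_eq_one_of_mem_policies {π : EuclideanSpace ℝ (S × A)} (h : π ∈ policies S A) (s : S) :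
    ∑ a, π (s, a) = 1 :=
  (h s).2

lemma norm_sq_eq_sum_row [Fintype S] (π : EuclideanSpace ℝ (S × A)) :
    ‖π‖ ^ 2 = ∑ s, ‖row π s‖ ^ 2 := by
  simp [EuclideanSpace.norm_sq_eq, Fintype.sum_prod_type, row]

lemma convex_simplex : Convex ℝ (simplex A) := by
  intro p hp q hq a b ha hb hab
  exact convex_stdSimplex ℝ A hp hq ha hb hab

lemma convex_policies : Convex ℝ (policies S A) := fun _ hp _ hq _ _ ha hb hab s =>
  convex_simplex (hp s) (hq s) ha hb hab

lemma isCompact_policies [Fintype S] : IsCompact (policies S A) := by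
  have hcl : IsClosed (policies S A) := by
    have : policies S A =
        ⋂ s, (fun π : EuclideanSpace ℝ (S × A) => fun a => π (s, a)) ⁻¹' stdSimplex ℝ A := by
      ext π; simp [policies, simplex, row]
    rw [this]
    exact isClosed_iInter fun s => (isClosed_stdSimplex ℝ A).preimage (by fun_prop)
  refine Metric.isCompact_of_isClosed_isBounded hcl ?_
  refine (Metric.isBounded_closedBall (x := 0) (r := √(∑ _x : S × A, (1 : ℝ) ^ 2))).subset ?_
  intro π hπ
  rw [mem_closedBall_zero_iff, EuclideanSpace.norm_eq]
  refine Real.sqrt_le_sqrt (Finset.sum_le_sum fun x _ => ?_)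
  have h0 := nonneg_of_mem_policies hπ x
  have h1 : π x ≤ 1 := by
    rw [← sum_eq_one_of_mem_policies hπ x.1]
    exact Finset.single_le_sum (f := fun a => π (x.1, a))
      (fun a _ => nonneg_of_mem_policies hπ _) (Finset.mem_univ x.2)
  rw [Real.norm_of_nonneg h0]
  gcongr

/-- The squared Euclidean diameter of the simplex is at most `2`. -/
lemma norm_sub_sq_le_two {p q : EuclideanSpace ℝ A} (hp : p ∈ simplex A) (hq : q ∈ simplex A) :
    ‖p - q‖ ^ 2 ≤ 2 := by
  have key : ∀ a, ‖(p - q) a‖ ^ 2 ≤ p a + q a := by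
    intro a
    have hp1 : p a ≤ 1 := (mem_Icc_of_mem_stdSimplex hp a).2
    have hq1 : q a ≤ 1 := (mem_Icc_of_mem_stdSimplex hq a).2
    have hp0 : 0 ≤ p a := hp.1 a
    have hq0 : 0 ≤ q a := hq.1 a
    simp only [PiLp.sub_apply, Real.norm_eq_abs, sq_abs]
    nlinarith [mul_nonneg hp0 hq0]
  calc ‖p - q‖ ^ 2 = ∑ a, ‖(p - q) a‖ ^ 2 := EuclideanSpace.norm_sq_eq _
    _ ≤ ∑ a, (p a + q a) := Finset.sum_le_sum fun a _ => key a
    _ = 2 := by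
      rw [Finset.sum_add_distrib, show ∑ a, p a = 1 from hp.2, show ∑ a, q a = 1 from hq.2]
      norm_num

lemma MDP.startAt_nonneg [DecidableEq S] {π : EuclideanSpace ℝ (S × A)}
    (hπ : π ∈ policies S A) (s : S) (x : S × A) :
    0 ≤ MDP.startAt π s x := by
  unfold MDP.startAt
  split_ifs
  exacts [nonneg_of_mem_policies hπ x, le_rfl]

end Policies

namespace MDP

/-! ### State-action laws and occupancy measures -/

variable {S A : Type*} [Fintype S] [Fintype A] (M : MDP S A)

section Law

variable {π : EuclideanSpace ℝ (S × A)}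

lemma law_nonneg (hπ : π ∈ policies S A) {ν : S × A → ℝ} (hν : ∀ x, 0 ≤ ν x) (τ : ℕ)
    (x : S × A) : 0 ≤ M.law π ν τ x := by
  induction τ generalizing x with
  | zero => exact hν x
  | succ τ ih =>
    exact mul_nonneg (Finset.sum_nonneg fun y _ => mul_nonneg (ih y) ((M.P_mem _ _).1 _))
      (nonneg_of_mem_policies hπ x)

lemma sum_law (hπ : π ∈ policies S A) (ν : S × A → ℝ) (τ : ℕ) :
    ∑ x, M.law π ν τ x = ∑ x, ν x := by
  induction τ with
  | zero => rfl
  | succ τ ih =>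
    rw [← ih]
    simp only [law]
    rw [Fintype.sum_prod_type]
    simp only [← Finset.mul_sum, sum_eq_one_of_mem_policies hπ, mul_one]
    rw [Finset.sum_comm]
    simp only [← Finset.mul_sum, (M.P_mem _ _).2, mul_one]

lemma law_le_sum (hπ : π ∈ policies S A) {ν : S × A → ℝ} (hν : ∀ x, 0 ≤ ν x) (τ : ℕ)
    (x : S × A) : M.law π ν τ x ≤ ∑ x, ν x := by
  rw [← M.sum_law hπ ν τ]
  exact Finset.single_le_sum (fun y _ => M.law_nonneg hπ hν τ y) (Finset.mem_univ x)

lemma summable_law (hπ : π ∈ policies S A) {ν : S × A → ℝ} (hν : ∀ x, 0 ≤ ν x) (x : S × A) :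
    Summable fun τ : ℕ => M.γ ^ τ * M.law π ν τ x := by
  refine Summable.of_nonneg_of_le
    (fun τ => mul_nonneg (pow_nonneg M.γ_nonneg τ) (M.law_nonneg hπ hν τ x))
    (fun τ => mul_le_mul_of_nonneg_left (M.law_le_sum hπ hν τ x) (pow_nonneg M.γ_nonneg τ)) ?_
  exact (summable_geometric_of_lt_one M.γ_nonneg M.γ_lt_one).mul_right _

/-- The chain restarted after its first step. -/
lemma law_succ' (ν : S × A → ℝ) (τ : ℕ) :
    M.law π ν (τ + 1) = M.law π (M.law π ν 1) τ := by
  induction τ with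
  | zero => rfl
  | succ τ ih =>
    funext x
    rw [law, ih]
    rfl

/-- The law at time `τ` depends linearly on the initial law. -/
lemma law_eq_sum_single [DecidableEq S] [DecidableEq A] (ν : S × A → ℝ) (τ : ℕ) (x : S × A) :
    M.law π ν τ x = ∑ y, ν y * M.law π (Pi.single y 1) τ x := by
  induction τ generalizing x with
  | zero =>
    change ν x = ∑ y, ν y * (Pi.single y 1 : S × A → ℝ) x
    simp [Pi.single_apply]
  | succ τ ih =>
    simp only [law]
    simp_rw [ih, Finset.sum_mul, Finset.mul_sum]
    rw [Finset.sum_comm]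
    exact Finset.sum_congr rfl fun y _ => Finset.sum_congr rfl fun z _ => by ring

end Law

lemma inner_eq_sum_row (r μ : EuclideanSpace ℝ (S × A)) :
    inner ℝ r μ = ∑ s, ∑ a, μ (s, a) * r (s, a) := by
  rw [PiLp.inner_apply, Fintype.sum_prod_type]
  rfl

variable [DecidableEq S] {π : EuclideanSpace ℝ (S × A)}

/-- The unnormalised state visitation measure `∑_a μ^π(s, a)`. -/
noncomputable def stateOccupancy (M : MDP S A) (π : EuclideanSpace ℝ (S × A)) (s : S) : ℝ :=
  ∑ a, M.occupancy π (s, a)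

lemma visitation_div (s : S) : M.visitation π s / (1 - M.γ) = M.stateOccupancy π s :=
  mul_div_cancel_left₀ _ (sub_ne_zero.2 M.γ_lt_one.ne')


/-- The occupancy measure solves the fixed-point equation
`μ(s, a) = (ρ(s) + γ ∑ P(s | y) μ(y)) π(a | s)`. -/
lemma occupancy_apply (hπ : π ∈ policies S A) (x : S × A) :
    M.occupancy π x = (M.ρ x.1 + M.γ * ∑ y, M.P y.1 y.2 x.1 * M.occupancy π y) * π x := by
  have hs := fun s y => M.summable_law hπ (startAt_nonneg hπ s) y
  have h1 : ∀ s, ∑' τ : ℕ, M.γ ^ τ * M.law π (startAt π s) τ x = startAt π s x +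
      M.γ * (∑ y, M.P y.1 y.2 x.1 * ∑' τ : ℕ, M.γ ^ τ * M.law π (startAt π s) τ y) * π x := by
    intro s
    rw [(hs s x).tsum_eq_zero_add]
    congr 1
    · simp [law]
    · simp_rw [← tsum_mul_left]
      rw [← Summable.tsum_finsetSum fun y _ => (hs s y).mul_left _, ← tsum_mul_left,
        ← tsum_mul_right]
      refine tsum_congr fun τ => ?_
      simp only [law, Finset.mul_sum, Finset.sum_mul]
      exact Finset.sum_congr rfl fun y _ => by ring
  have h2 : ∑ s, M.ρ s * startAt π s x = M.ρ x.1 * π x := by simp [startAt]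
  simp only [occupancy]
  simp_rw [h1, mul_add, Finset.sum_add_distrib]
  rw [h2, add_mul]
  congr 1
  simp_rw [Finset.mul_sum, Finset.sum_mul, Finset.mul_sum]
  rw [Finset.sum_comm]
  exact Finset.sum_congr rfl fun y _ => Finset.sum_congr rfl fun z _ => by ring

lemma stateOccupancy_eq (hπ : π ∈ policies S A) (s : S) :
    M.stateOccupancy π s = M.ρ s + M.γ * ∑ y, M.P y.1 y.2 s * M.occupancy π y := by
  simp only [stateOccupancy]
  simp_rw [M.occupancy_apply hπ (s, _)]
  rw [← Finset.mul_sum, sum_eq_one_of_mem_policies hπ, mul_one]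

lemma occupancy_eq_mul (hπ : π ∈ policies S A) (x : S × A) :
    M.occupancy π x = M.stateOccupancy π x.1 * π x := by
  rw [M.stateOccupancy_eq hπ, ← M.occupancy_apply hπ]

lemma occupancy_nonneg (hπ : π ∈ policies S A) (x : S × A) : 0 ≤ M.occupancy π x :=
  Finset.sum_nonneg fun s _ => mul_nonneg (M.ρ_mem.1 s) <| tsum_nonneg fun τ =>
    mul_nonneg (pow_nonneg M.γ_nonneg τ) (M.law_nonneg hπ (startAt_nonneg hπ s) τ x)

lemma occupancy_mem (hπ : π ∈ policies S A) : M.occupancy π ∈ M.occupancySet := by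
  refine ⟨M.occupancy_nonneg hπ, fun s => ?_⟩
  have := M.stateOccupancy_eq hπ s
  rwa [Fintype.sum_prod_type] at this

lemma le_stateOccupancy (hπ : π ∈ policies S A) (s : S) : M.ρ s ≤ M.stateOccupancy π s := by
  rw [M.stateOccupancy_eq hπ]
  exact le_add_of_nonneg_right <| mul_nonneg M.γ_nonneg <| Finset.sum_nonneg fun y _ =>
    mul_nonneg ((M.P_mem _ _).1 _) (M.occupancy_nonneg hπ y)

lemma stateOccupancy_nonneg (hπ : π ∈ policies S A) (s : S) : 0 ≤ M.stateOccupancy π s :=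
  (M.ρ_mem.1 s).trans (M.le_stateOccupancy hπ s)

/-- The state occupancy is at least `ρmin`, so with step size `ρmin / L` the weighted proximal term
dominates the quadratic error allowed by `L`-smoothness. -/
lemma smoothness_error_le {ρmin L : ℝ} (hρmin : 0 < ρmin)
    (hρ : ∀ s, ρmin ≤ M.ρ s) (hL : 0 < L) (hπ : π ∈ policies S A) (v : S → ℝ) :
    L / 2 * ∑ s, v s ^ 2 ≤
      ∑ s, M.stateOccupancy π s * (1 / (2 * (ρmin / L)) * v s ^ 2) := by
  rw [Finset.mul_sum]
  refine Finset.sum_le_sum fun s _ => ?_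
  have hw : ρmin ≤ M.stateOccupancy π s := (hρ s).trans (M.le_stateOccupancy hπ s)
  have : L / 2 * v s ^ 2 = ρmin * (1 / (2 * (ρmin / L)) * v s ^ 2) := by field_simp
  rw [this]
  exact mul_le_mul_of_nonneg_right hw (by positivity)

lemma sum_stateOccupancy (hπ : π ∈ policies S A) :
    ∑ s, M.stateOccupancy π s = 1 / (1 - M.γ) := by
  have h : ∑ s, M.stateOccupancy π s = 1 + M.γ * ∑ s, M.stateOccupancy π s := by
    conv_lhs => simp only [M.stateOccupancy_eq hπ]
    rw [Finset.sum_add_distrib, M.ρ_mem.2, ← Finset.mul_sum, Finset.sum_comm]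
    simp only [← Finset.sum_mul, (M.P_mem _ _).2, one_mul]
    rw [Fintype.sum_prod_type]
    rfl
  rw [eq_div_iff (sub_ne_zero.2 M.γ_lt_one.ne')]
  linarith

lemma stateOccupancy_le (hπ : π ∈ policies S A) (s : S) :
    M.stateOccupancy π s ≤ 1 / (1 - M.γ) := by
  rw [← M.sum_stateOccupancy hπ]
  exact Finset.single_le_sum (fun s _ => M.stateOccupancy_nonneg hπ s) (Finset.mem_univ s)

/-! ### Action values and the performance difference -/

/-- The Bellman equation for `Q`. -/
lemma Q_eq [DecidableEq A] (hπ : π ∈ policies S A) (r : EuclideanSpace ℝ (S × A)) (s : S) (a : A) :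
    M.Q π r s a = r (s, a) + M.γ * ∑ s', M.P s a s' * ∑ a', π (s', a') * M.Q π r s' a' := by
  have hs : ∀ y, Summable fun τ : ℕ => M.γ ^ τ * ∑ x, M.law π (Pi.single y 1) τ x * r x := by
    intro y
    have h := summable_sum fun (x : S × A) (_ : x ∈ Finset.univ) =>
      (M.summable_law hπ (ν := Pi.single y 1)
        (fun z => (Pi.single_nonneg.2 zero_le_one : (0 : S × A → ℝ) ≤ Pi.single y 1) z)
        x).mul_right (r x)
    refine h.congr fun τ => ?_
    rw [Finset.mul_sum]
    exact Finset.sum_congr rfl fun x _ => by ring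
  have h1 : ∀ z, M.law π (Pi.single (s, a) 1) 1 z = M.P s a z.1 * π z := by
    intro z
    simp [law, Pi.single_apply]
  have h2 : ∀ τ, ∑ x, M.law π (Pi.single (s, a) 1) (τ + 1) x * r x =
      ∑ z : S × A, M.P s a z.1 * π z * ∑ x, M.law π (Pi.single z 1) τ x * r x := by
    intro τ
    rw [law_succ']
    simp_rw [M.law_eq_sum_single (M.law π (Pi.single (s, a) 1) 1) τ, h1,
      Finset.sum_mul, Finset.mul_sum]
    rw [Finset.sum_comm]
    exact Finset.sum_congr rfl fun y _ => Finset.sum_congr rfl fun z _ => by ring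
  rw [Q, (hs (s, a)).tsum_eq_zero_add]
  congr 1
  · simp [law, Pi.single_apply]
  · simp_rw [h2]
    have h3 : ∀ τ, M.γ ^ (τ + 1) * ∑ z : S × A, M.P s a z.1 * π z *
        ∑ x, M.law π (Pi.single z 1) τ x * r x = M.γ * ∑ z : S × A, M.P s a z.1 * π z *
        (M.γ ^ τ * ∑ x, M.law π (Pi.single z 1) τ x * r x) := by
      intro τ
      rw [Finset.mul_sum, Finset.mul_sum]
      exact Finset.sum_congr rfl fun z _ => by ring
    simp_rw [h3]
    rw [tsum_mul_left, Summable.tsum_finsetSum fun z _ => (hs z).mul_left _]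
    simp_rw [tsum_mul_left]
    rw [Fintype.sum_prod_type]
    congr 1
    refine Finset.sum_congr rfl fun s' _ => ?_
    rw [Finset.mul_sum]
    exact Finset.sum_congr rfl fun a' _ => by rw [Q]; ring

/-- Testing a feasible occupancy measure against `r` gives the value of `π` for `r` plus the
advantages of `π` weighted by `μ`; the flow constraints turn the Bellman equation into a
telescoping identity. -/
lemma inner_eq_value_add_advantage [DecidableEq A] (hπ : π ∈ policies S A)
    (r : EuclideanSpace ℝ (S × A)) {μ : EuclideanSpace ℝ (S × A)} (hμ : μ ∈ M.occupancySet) :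
    inner ℝ r μ = ∑ s, M.ρ s * ∑ a', π (s, a') * M.Q π r s a' +
      ∑ s, ∑ a, μ (s, a) * (M.Q π r s a - ∑ a', π (s, a') * M.Q π r s a') := by
  set V : S → ℝ := fun s => ∑ a', π (s, a') * M.Q π r s a' with hV
  have hr : ∀ s a, r (s, a) = M.Q π r s a - M.γ * ∑ s', M.P s a s' * V s' := by
    intro s a
    rw [M.Q_eq hπ r s a]
    ring
  have hflow : ∑ s, (∑ a, μ (s, a)) * V s =
      ∑ s, M.ρ s * V s + M.γ * ∑ s, ∑ a, μ (s, a) * ∑ s', M.P s a s' * V s' := by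
    simp_rw [hμ.2, add_mul, Finset.sum_add_distrib]
    congr 1
    simp_rw [Finset.mul_sum, Finset.sum_mul]
    rw [Finset.sum_comm]
    refine Finset.sum_congr rfl fun s _ => ?_
    rw [Finset.sum_comm]
    exact Finset.sum_congr rfl fun a _ => Finset.sum_congr rfl fun s' _ => by ring
  rw [inner_eq_sum_row]
  change _ = ∑ s, M.ρ s * V s + ∑ s, ∑ a, μ (s, a) * (M.Q π r s a - V s)
  simp_rw [hr, mul_sub, Finset.sum_sub_distrib, ← Finset.sum_mul]
  rw [hflow]
  simp_rw [Finset.mul_sum]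
  have : ∀ s a, ∑ s', μ (s, a) * (M.γ * (M.P s a s' * V s')) =
      ∑ s', M.γ * (μ (s, a) * (M.P s a s' * V s')) := fun s a =>
    Finset.sum_congr rfl fun s' _ => by ring
  simp_rw [this]
  ring

/-- The performance difference lemma, for the reward `r`. -/
lemma inner_occupancy_sub [DecidableEq A] (hπ : π ∈ policies S A) {π' : EuclideanSpace ℝ (S × A)}
    (hπ' : π' ∈ policies S A) (r : EuclideanSpace ℝ (S × A)) :
    inner ℝ r (M.occupancy π' - M.occupancy π) =
      ∑ s, M.stateOccupancy π' s * inner ℝ (M.Qrow π r s) (row π' s - row π s) := by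
  have key : ∀ π'' ∈ policies S A, ∑ s, ∑ a, M.occupancy π'' (s, a) *
      (M.Q π r s a - ∑ a', π (s, a') * M.Q π r s a') =
      ∑ s, M.stateOccupancy π'' s * inner ℝ (M.Qrow π r s) (row π'' s - row π s) := by
    intro π'' h''
    refine Finset.sum_congr rfl fun s _ => ?_
    have : inner ℝ (M.Qrow π r s) (row π'' s - row π s) =
        ∑ a, π'' (s, a) * M.Q π r s a - ∑ a, π (s, a) * M.Q π r s a := by
      rw [PiLp.inner_apply, ← Finset.sum_sub_distrib]
      refine Finset.sum_congr rfl fun a _ => ?_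
      simp [Qrow, row]
      ring
    rw [this]
    simp_rw [M.occupancy_eq_mul h'', mul_assoc, ← Finset.mul_sum, mul_sub,
      Finset.sum_sub_distrib, ← Finset.sum_mul, sum_eq_one_of_mem_policies h'']
    ring
  rw [inner_sub_right, M.inner_eq_value_add_advantage hπ r (M.occupancy_mem hπ'),
    M.inner_eq_value_add_advantage hπ r (M.occupancy_mem hπ), key _ hπ', key _ hπ]
  simp

end MDP

/-! ### Gradients relative to a convex set -/

section DirectionalDerivative

open Filter Topology AffineMap

variable {E : Type*} [NormedAddCommGroup E] [InnerProductSpace ℝ E] [CompleteSpace E]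

lemma hasDerivWithinAt_comp_of_hasGradientWithinAt {f : E → ℝ} {g : E} {s : Set E} {c : ℝ → E}
    {c' : E} {u : Set ℝ} {t : ℝ} (hf : HasGradientWithinAt f g s (c t))
    (hc : HasDerivWithinAt c c' u t) (hm : Set.MapsTo c u s) :
    HasDerivWithinAt (fun t => f (c t)) (inner ℝ g c') u t := by
  have := hf.hasFDerivWithinAt.comp_hasDerivWithinAt t hc hm
  simpa [Function.comp_def] using this

lemma hasDerivWithinAt_lineMap_of_hasGradientWithinAt {f : E → ℝ} {g : E} {s : Set E} {x y : E}
    (hs : Convex ℝ s) (hx : x ∈ s) (hy : y ∈ s) (hf : HasGradientWithinAt f g s x) :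
    HasDerivWithinAt (fun t : ℝ => f (lineMap x y t)) (inner ℝ g (y - x)) (Set.Icc 0 1) 0 := by
  refine hasDerivWithinAt_comp_of_hasGradientWithinAt (c := fun t : ℝ => lineMap x y t) ?_
    AffineMap.hasDerivWithinAt_lineMap fun t ht => hs.lineMap_mem hx hy ht
  simpa using hf

/-- The gradient inequality for concave functions, with a gradient relative to the set. -/
lemma ConcaveOn.sub_le_inner_of_hasGradientWithinAt {f : E → ℝ} {g : E} {s : Set E} {x y : E}
    (hf : ConcaveOn ℝ s f) (hx : x ∈ s) (hy : y ∈ s) (hg : HasGradientWithinAt f g s x) :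
    f y - f x ≤ inner ℝ g (y - x) := by
  have h := hasDerivWithinAt_lineMap_of_hasGradientWithinAt hf.1 hx hy hg
  rw [hasDerivWithinAt_iff_tendsto_slope, Set.Icc_sdiff_left] at h
  have : (𝓝[Set.Ioc (0 : ℝ) 1] 0).NeBot := by
    rw [nhdsWithin_Ioc_eq_nhdsGT zero_lt_one]; infer_instance
  refine ge_of_tendsto h ?_
  filter_upwards [self_mem_nhdsWithin] with t ht
  have h1 := hf.2 hx hy (sub_nonneg.2 ht.2) ht.1.le (sub_add_cancel 1 t)
  rw [slope_def_field, le_div_iff₀ (by linarith [ht.1]), lineMap_apply_zero, lineMap_apply_module]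
  simp only [smul_eq_mul] at h1
  linarith

end DirectionalDerivative

/-! ### The policy gradient -/

namespace MDP

open Filter Topology AffineMap

variable {S A : Type*} [Fintype S] [Fintype A] [DecidableEq S] [DecidableEq A] (M : MDP S A)
  {π π' p : EuclideanSpace ℝ (S × A)} {F : EuclideanSpace ℝ (S × A) → ℝ}
  {g : EuclideanSpace ℝ (S × A)}

lemma inner_occupancy_lineMap_sub (hπ : π ∈ policies S A) (hπ' : π' ∈ policies S A)
    (r : EuclideanSpace ℝ (S × A)) {t : ℝ} (ht : t ∈ Set.Icc (0 : ℝ) 1) :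
    inner ℝ r (M.occupancy (lineMap π π' t) - M.occupancy π) =
      t * ∑ s, M.stateOccupancy (lineMap π π' t) s *
        inner ℝ (M.Qrow π r s) (row π' s - row π s) := by
  rw [M.inner_occupancy_sub hπ (convex_policies.lineMap_mem hπ hπ' ht), Finset.mul_sum]
  refine Finset.sum_congr rfl fun s _ => ?_
  rw [← row_sub, ← row_sub, lineMap_apply, vsub_eq_sub, vadd_eq_add, add_sub_cancel_right,
    row_smul, inner_smul_right]
  ring

/-- The state occupancy varies continuously along a segment of policies, by the performance
difference lemma for the indicator rewards. -/
lemma continuousWithinAt_stateOccupancy_lineMap (hπ : π ∈ policies S A)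
    (hπ' : π' ∈ policies S A) (s : S) :
    ContinuousWithinAt (fun t : ℝ => M.stateOccupancy (lineMap π π' t) s) (Set.Icc 0 1) 0 := by
  refine tendsto_finsetSum _ fun a _ => ?_
  set r : EuclideanSpace ℝ (S × A) := EuclideanSpace.single (s, a) 1
  -- The difference of the occupancy measures is `t` times a bounded quantity.
  have hb : ∀ t ∈ Set.Icc (0 : ℝ) 1, |M.occupancy (lineMap π π' t) (s, a) -
      M.occupancy π (s, a)| ≤
      t * ∑ s', 1 / (1 - M.γ) * |inner ℝ (M.Qrow π r s') (row π' s' - row π s')| := by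
    intro t ht
    have h := M.inner_occupancy_lineMap_sub hπ hπ' r ht
    rw [EuclideanSpace.inner_single_left, map_one, one_mul, PiLp.sub_apply] at h
    rw [h, abs_mul, abs_of_nonneg ht.1]
    refine mul_le_mul_of_nonneg_left ?_ ht.1
    refine (Finset.abs_sum_le_sum_abs _ _).trans (Finset.sum_le_sum fun s' _ => ?_)
    have hp := convex_policies.lineMap_mem hπ hπ' ht
    rw [abs_mul, abs_of_nonneg (M.stateOccupancy_nonneg hp s')]
    exact mul_le_mul_of_nonneg_right (M.stateOccupancy_le hp s') (abs_nonneg _)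
  rw [tendsto_iff_dist_tendsto_zero]
  simp only [lineMap_apply_zero, Real.dist_eq]
  refine squeeze_zero' (Eventually.of_forall fun _ => abs_nonneg _)
    (eventually_nhdsWithin_of_forall hb) ?_
  refine (Continuous.tendsto' (by fun_prop) 0 0 (by simp)).mono_left nhdsWithin_le_nhds

lemma hasDerivWithinAt_inner_occupancy (hπ : π ∈ policies S A) (hπ' : π' ∈ policies S A)
    (r : EuclideanSpace ℝ (S × A)) :
    HasDerivWithinAt (fun t : ℝ => inner ℝ r (M.occupancy (lineMap π π' t)))
      (∑ s, M.stateOccupancy π s * inner ℝ (M.Qrow π r s) (row π' s - row π s))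
      (Set.Icc 0 1) 0 := by
  rw [hasDerivWithinAt_iff_tendsto_slope]
  have h : Tendsto (fun t : ℝ => ∑ s, M.stateOccupancy (lineMap π π' t) s *
      inner ℝ (M.Qrow π r s) (row π' s - row π s)) (𝓝[Set.Icc 0 1 \ {0}] 0)
      (𝓝 (∑ s, M.stateOccupancy π s * inner ℝ (M.Qrow π r s) (row π' s - row π s))) := by
    refine tendsto_finsetSum _ fun s _ => Tendsto.mul_const _ ?_
    have := (M.continuousWithinAt_stateOccupancy_lineMap hπ hπ' s).mono_left
      (nhdsWithin_mono 0 (Set.sdiff_subset (s := Set.Icc (0 : ℝ) 1) (t := {0})))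
    simpa using this
  refine h.congr' ?_
  filter_upwards [self_mem_nhdsWithin] with t ht
  have ht0 : t ≠ 0 := ht.2
  rw [slope_def_field, lineMap_apply_zero, ← inner_sub_right, sub_zero,
    M.inner_occupancy_lineMap_sub hπ hπ' r ht.1, mul_div_cancel_left₀ _ ht0]

/-- The policy gradient theorem for a general utility: along the segment from `π` to `π'`, the
utility has slope `∑ₛ w(s) ⟨Q(s, ·), π'(s, ·) - π(s, ·)⟩` at `π`, where `Q` is taken for the
pseudo-reward `g`, the gradient of `F` at `μ^π`. -/
lemma hasDerivWithinAt_utility (hπ : π ∈ policies S A) (hπ' : π' ∈ policies S A)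
    (hF : HasGradientWithinAt F g M.occupancySet (M.occupancy π)) :
    HasDerivWithinAt (fun t : ℝ => M.utility F (lineMap π π' t))
      (∑ s, M.stateOccupancy π s * inner ℝ (M.Qrow π g s) (row π' s - row π s))
      (Set.Icc 0 1) 0 := by
  set D : EuclideanSpace ℝ (S × A) := WithLp.toLp 2 fun x => ∑ s, M.stateOccupancy π s *
    inner ℝ (M.Qrow π (EuclideanSpace.single x 1) s) (row π' s - row π s)
  have hD : HasDerivWithinAt (fun t : ℝ => M.occupancy (lineMap π π' t)) D (Set.Icc 0 1) 0 := by
    rw [hasDerivWithinAt_iff_hasFDerivWithinAt, hasFDerivWithinAt_euclidean]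
    intro x
    have h := (M.hasDerivWithinAt_inner_occupancy hπ hπ'
      (EuclideanSpace.single x 1)).hasFDerivWithinAt
    simp only [EuclideanSpace.inner_single_left, map_one, one_mul] at h
    have hx : (PiLp.proj 2 (fun _ : S × A => ℝ) x).comp
        (ContinuousLinearMap.toSpanSingleton ℝ D) =
        ContinuousLinearMap.toSpanSingleton ℝ (D x) := by
      ext
      simp
    rw [hx]
    exact h
  -- `⟨g, D⟩` is the derivative of `⟨g, μ⟩` along the segment, which is already known.
  have huniq := UniqueDiffWithinAt.eq_deriv _
    (uniqueDiffOn_Icc (zero_lt_one (α := ℝ)) 0 (by simp))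
    (M.hasDerivWithinAt_inner_occupancy hπ hπ' g)
    ((innerSL ℝ g).hasFDerivAt.comp_hasDerivWithinAt (0 : ℝ) hD)
  rw [huniq]
  refine hasDerivWithinAt_comp_of_hasGradientWithinAt (f := F)
    (c := fun t : ℝ => M.occupancy (lineMap π π' t)) (by simpa using hF) hD fun t ht => ?_
  exact M.occupancy_mem (convex_policies.lineMap_mem hπ hπ' ht)

/-- Any gradient of the utility relative to the policies agrees with the policy gradient in the
feasible directions. -/
lemma inner_gradientWithin_utility (hπ : π ∈ policies S A) (hπ' : π' ∈ policies S A)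
    (hF : HasGradientWithinAt F g M.occupancySet (M.occupancy π))
    (hG : DifferentiableWithinAt ℝ (M.utility F) (policies S A) π) :
    inner ℝ (gradientWithin (M.utility F) (policies S A) π) (π' - π) =
      ∑ s, M.stateOccupancy π s * inner ℝ (M.Qrow π g s) (row π' s - row π s) :=
  UniqueDiffWithinAt.eq_deriv _ (uniqueDiffOn_Icc (zero_lt_one (α := ℝ)) 0 (by simp))
    (hasDerivWithinAt_lineMap_of_hasGradientWithinAt convex_policies hπ hπ'
      hG.hasGradientWithinAt)
    (M.hasDerivWithinAt_utility hπ hπ' hF)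

/-! ### Projected Q-ascent steps -/

variable {ρmin L : ℝ}

lemma stepObjective_eq (η : ℝ) (r π π' : EuclideanSpace ℝ (S × A)) :
    M.stepObjective η r π π' = ∑ s, M.stateOccupancy π s *
      (inner ℝ (M.Qrow π r s) (row π' s - row π s) -
        1 / (2 * η) * ‖row π' s - row π s‖ ^ 2) := by
  simp only [stepObjective, visitation_div, mul_sub, Finset.sum_sub_distrib, Finset.mul_sum]
  congr 1
  exact Finset.sum_congr rfl fun s _ => by ring

/-- Completing the square: each projection maximises the summand of its state, so the statewise
form of a step also maximises the objective of the other form. -/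
lemma IsProjStep.isArgmaxStep {η : ℝ} (hη : 0 < η) {r : EuclideanSpace ℝ (S × A)}
    (hπ : π ∈ policies S A) (h : M.IsProjStep η r π π') : M.IsArgmaxStep η r π π' := by
  refine ⟨fun s => (h s).1, fun p hp => ?_⟩
  change M.stepObjective η r π p ≤ M.stepObjective η r π π'
  rw [stepObjective_eq, stepObjective_eq]
  refine Finset.sum_le_sum fun s _ =>
    mul_le_mul_of_nonneg_left ?_ (M.stateOccupancy_nonneg hπ s)
  have hmin : ‖row π' s - (row π s + η • M.Qrow π r s)‖ ≤
      ‖row p s - (row π s + η • M.Qrow π r s)‖ := (h s).2 (hp s)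
  have hsq := pow_le_pow_left₀ (norm_nonneg _) hmin 2
  have key : ∀ q : EuclideanSpace ℝ A, inner ℝ (M.Qrow π r s) (q - row π s) -
      1 / (2 * η) * ‖q - row π s‖ ^ 2 = η / 2 * ‖M.Qrow π r s‖ ^ 2 -
      1 / (2 * η) * ‖q - (row π s + η • M.Qrow π r s)‖ ^ 2 := by
    intro q
    rw [← sub_sub, norm_sub_sq_real (q - row π s), inner_smul_right, norm_smul, mul_pow,
      real_inner_comm, Real.norm_eq_abs, sq_abs]
    field_simp
    ring
  rw [key, key]
  gcongr

/-- Two-sided quadratic bound on the utility around `π`, in terms of the policy gradient. -/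
lemma abs_utility_sub_le (hG : SmoothOnWith L (M.utility F) (policies S A))
    (hπ : π ∈ policies S A) (hp : p ∈ policies S A)
    (hg : HasGradientWithinAt F g M.occupancySet (M.occupancy π)) :
    |M.utility F p - M.utility F π -
      ∑ s, M.stateOccupancy π s * inner ℝ (M.Qrow π g s) (row p s - row π s)| ≤
      L / 2 * ∑ s, ‖row p s - row π s‖ ^ 2 := by
  have h := hG.2 p hp π hπ
  rwa [M.inner_gradientWithin_utility hπ hp hg (hG.1 π hπ), norm_sq_eq_sum_row] at h

/-- A step improves the utility at least by the value of the step objective at any policy `p`. -/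
lemma IsArgmaxStep.utility_add_stepObjective_le (hρmin : 0 < ρmin) (hρ : ∀ s, ρmin ≤ M.ρ s)
    (hL : 0 < L) (hG : SmoothOnWith L (M.utility F) (policies S A))
    (hπ : π ∈ policies S A) (hg : HasGradientWithinAt F g M.occupancySet (M.occupancy π))
    (hstep : M.IsArgmaxStep (ρmin / L) g π π') (hp : p ∈ policies S A) :
    M.utility F π + M.stepObjective (ρmin / L) g π p ≤ M.utility F π' := by
  have h1 : M.stepObjective (ρmin / L) g π p ≤ M.stepObjective (ρmin / L) g π π' := hstep.2 hp
  have h2 := (abs_le.1 (M.abs_utility_sub_le hG hπ hstep.1 hg)).1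
  have h3 := M.smoothness_error_le hρmin hρ hL hπ fun s => ‖row π' s - row π s‖
  rw [M.stepObjective_eq _ _ _ π'] at h1
  simp only [mul_sub, Finset.sum_sub_distrib] at h1
  linarith

/-- Comparing a step with the jump to `p` bounds the gap to `p` after the step, whatever the gap
was before. -/
lemma IsArgmaxStep.utility_sub_le (hρmin : 0 < ρmin) (hρ : ∀ s, ρmin ≤ M.ρ s)
    (hL : 0 < L) (hG : SmoothOnWith L (M.utility F) (policies S A))
    (hπ : π ∈ policies S A) (hg : HasGradientWithinAt F g M.occupancySet (M.occupancy π))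
    (hstep : M.IsArgmaxStep (ρmin / L) g π π') (hp : p ∈ policies S A) :
    M.utility F p - M.utility F π' ≤ 2 * L / ((1 - M.γ) * ρmin) := by
  have h1 := IsArgmaxStep.utility_add_stepObjective_le M hρmin hρ hL hG hπ hg hstep hp
  have h2 := (abs_le.1 (M.abs_utility_sub_le hG hπ hp hg)).2
  have h3 := M.smoothness_error_le hρmin hρ hL hπ fun s => ‖row p s - row π s‖
  have h4 : ∑ s, M.stateOccupancy π s *
      (1 / (2 * (ρmin / L)) * ‖row p s - row π s‖ ^ 2) ≤ L / ((1 - M.γ) * ρmin) := by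
    have hγ : 0 < 1 - M.γ := sub_pos.2 M.γ_lt_one
    calc _ ≤ ∑ s, M.stateOccupancy π s * (1 / (2 * (ρmin / L)) * 2) :=
          Finset.sum_le_sum fun s _ => mul_le_mul_of_nonneg_left
            (mul_le_mul_of_nonneg_left (norm_sub_sq_le_two (hp s) (hπ s)) (by positivity))
            (M.stateOccupancy_nonneg hπ s)
      _ = L / ((1 - M.γ) * ρmin) := by
          rw [← Finset.sum_mul, M.sum_stateOccupancy hπ]
          field_simp
  rw [stepObjective_eq] at h1
  simp only [mul_sub, Finset.sum_sub_distrib] at h1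
  have h5 : 2 * L / ((1 - M.γ) * ρmin) = 2 * (L / ((1 - M.γ) * ρmin)) := mul_div_assoc _ _ _
  linarith

/-- Concavity of `F` makes the gap to `p` at most the advantage of `p` over `π` for the
pseudo-reward, weighted by the occupancy of `p`. -/
lemma utility_sub_le_advantage (hF : ConcaveOn ℝ M.occupancySet F) (hπ : π ∈ policies S A)
    (hp : p ∈ policies S A) (hg : HasGradientWithinAt F g M.occupancySet (M.occupancy π)) :
    M.utility F p - M.utility F π ≤
      ∑ s, M.stateOccupancy p s * inner ℝ (M.Qrow π g s) (row p s - row π s) := by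
  rw [← M.inner_occupancy_sub hπ hp]
  exact ConcaveOn.sub_le_inner_of_hasGradientWithinAt hF (M.occupancy_mem hπ)
    (M.occupancy_mem hp) hg

/-- One step of the method from `π`, compared with the statewise mixture of `π` and `p` whose
fractions `α w^p(s) / w^π(s)` turn the occupancy of `π` into that of `p`. -/
lemma IsArgmaxStep.utility_sub_le_recursion (hF : ConcaveOn ℝ M.occupancySet F)
    (hρmin : 0 < ρmin) (hρ : ∀ s, ρmin ≤ M.ρ s)
    (hL : 0 < L) (hG : SmoothOnWith L (M.utility F) (policies S A))
    (hπ : π ∈ policies S A) (hg : HasGradientWithinAt F g M.occupancySet (M.occupancy π))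
    (hstep : M.IsArgmaxStep (ρmin / L) g π π') (hp : p ∈ policies S A) {α : ℝ} (hα : 0 ≤ α)
    (hα' : α ≤ (1 - M.γ) * ρmin) :
    M.utility F p - M.utility F π' ≤ M.utility F p - M.utility F π -
      α * (M.utility F p - M.utility F π) + α ^ 2 * (L / ((1 - M.γ) * ρmin) ^ 2) := by
  have hγ : 0 < 1 - M.γ := sub_pos.2 M.γ_lt_one
  set w := M.stateOccupancy π with hw
  set v := M.stateOccupancy p with hv
  have hwρ : ∀ s, ρmin ≤ w s := fun s => (hρ s).trans (M.le_stateOccupancy hπ s)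
  have hw0 : ∀ s, 0 < w s := fun s => hρmin.trans_le (hwρ s)
  have hv0 : ∀ s, 0 ≤ v s := M.stateOccupancy_nonneg hp
  have hv1 : ∀ s, v s ≤ 1 / (1 - M.γ) := M.stateOccupancy_le hp
  set β : S → ℝ := fun s => α * v s / w s with hβ
  have hβ0 : ∀ s, 0 ≤ β s := fun s => div_nonneg (mul_nonneg hα (hv0 s)) (hw0 s).le
  have hβ1 : ∀ s, β s ≤ 1 := by
    intro s
    rw [hβ, div_le_one (hw0 s)]
    calc α * v s ≤ ((1 - M.γ) * ρmin) * (1 / (1 - M.γ)) :=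
          mul_le_mul hα' (hv1 s) (hv0 s) (by positivity)
      _ = ρmin := by field_simp
      _ ≤ w s := hwρ s
  have hq : statewiseMix β π p ∈ policies S A := fun s => by
    rw [row_statewiseMix]
    exact convex_simplex.add_smul_sub_mem (hπ s) (hp s) ⟨hβ0 s, hβ1 s⟩
  have h1 := IsArgmaxStep.utility_add_stepObjective_le M hρmin hρ hL hG hπ hg hstep hq
  have h2 := mul_le_mul_of_nonneg_left (M.utility_sub_le_advantage hF hπ hp hg) hα
  have h3 : α * ∑ s, v s * inner ℝ (M.Qrow π g s) (row p s - row π s) -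
      α ^ 2 * (L / ((1 - M.γ) * ρmin) ^ 2) ≤
      M.stepObjective (ρmin / L) g π (statewiseMix β π p) := by
    rw [stepObjective_eq]
    simp only [mul_sub, Finset.sum_sub_distrib, row_statewiseMix, add_sub_cancel_left,
      inner_smul_right, norm_smul, mul_pow, Real.norm_eq_abs, sq_abs]
    refine sub_le_sub (le_of_eq ?_) ?_
    · rw [Finset.mul_sum]
      refine Finset.sum_congr rfl fun s _ => ?_
      have := (hw0 s).ne'
      rw [hβ]
      field_simp
      rfl
    · calc _ ≤ ∑ s, α ^ 2 * (L / (ρmin ^ 2 * (1 - M.γ))) * v s := by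
            refine Finset.sum_le_sum fun s _ => ?_
            have e : w s * (1 / (2 * (ρmin / L)) * (β s ^ 2 * ‖row p s - row π s‖ ^ 2)) =
                α ^ 2 * (L / (2 * ρmin)) * v s * (v s / w s * ‖row p s - row π s‖ ^ 2) := by
              have := (hw0 s).ne'
              rw [hβ]
              field_simp
            have hr : v s / w s ≤ 1 / (1 - M.γ) / ρmin :=
              div_le_div₀ (by positivity) (hv1 s) hρmin (hwρ s)
            have hvs := hv0 s
            change w s * _ ≤ _
            rw [e]
            calc _ ≤ α ^ 2 * (L / (2 * ρmin)) * v s * (1 / (1 - M.γ) / ρmin * 2) :=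
                  mul_le_mul_of_nonneg_left (mul_le_mul hr (norm_sub_sq_le_two (hp s) (hπ s))
                    (by positivity) (by positivity)) (by positivity)
              _ = _ := by field_simp
        _ = α ^ 2 * (L / ((1 - M.γ) ^ 2 * ρmin ^ 2)) := by
            rw [← Finset.mul_sum, hv, M.sum_stateOccupancy hp]
            field_simp
  linarith

end MDP

/-! ### The rate -/

/-- A sequence with `δ (k + 1) ≤ δ k - δ k ^ 2 / (4 C)` decays like `8 C / k`. -/
lemma le_div_of_quadratic_decrease {δ : ℕ → ℝ} {C : ℝ} (hC : 0 < C) {n : ℕ} (hn : 1 ≤ n)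
    (h0 : δ n ≤ 8 * C / n)
    (hrec : ∀ k ≥ n, δ (k + 1) ≤ δ k - δ k ^ 2 / (4 * C)) {K : ℕ} (hK : n ≤ K) :
    δ K ≤ 8 * C / K := by
  induction K, hK using Nat.le_induction with
  | base => exact h0
  | succ K hK ih =>
    have hK1 : (1 : ℝ) ≤ K := by exact_mod_cast hn.trans hK
    have hr := hrec K hK
    push_cast
    have hpos : 0 ≤ δ K ^ 2 / (4 * C) := by positivity
    -- Either the bound at `K + 1` holds already at `K`, or the decrease is large enough.
    rcases le_or_gt (δ K) (8 * C / (K + 1)) with h | h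
    · linarith
    · have h1 : (8 * C / (K + 1)) ^ 2 / (4 * C) ≤ δ K ^ 2 / (4 * C) := by gcongr
      have h2 : 8 * C / K - (8 * C / (K + 1)) ^ 2 / (4 * C) ≤ 8 * C / (K + 1) := by
        have e : 8 * C / (K + 1) - (8 * C / K - (8 * C / (K + 1)) ^ 2 / (4 * C)) =
            8 * C * (K - 1) / (K * (K + 1) ^ 2) := by
          field_simp
          ring
        have : 0 ≤ 8 * C * ((K : ℝ) - 1) / (K * (K + 1) ^ 2) :=
          div_nonneg (mul_nonneg (by positivity) (by linarith)) (by positivity)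
        linarith
      linarith

end PQA

theorem mainTheorem3 {S A : Type*} [Fintype S] [Fintype A] [DecidableEq S] [DecidableEq A]
    (M : PQA.MDP S A)
    -- a concave utility on the feasible occupancy measures, and its gradient `Γ π` at `μ^π`
    (F : EuclideanSpace ℝ (S × A) → ℝ)
    (hF : ConcaveOn ℝ M.occupancySet F)
    (Γ : EuclideanSpace ℝ (S × A) → EuclideanSpace ℝ (S × A))
    (hΓ : ∀ π ∈ PQA.policies S A,
      HasGradientWithinAt F (Γ π) M.occupancySet (M.occupancy π))
    -- exploration
    (ρmin : ℝ) (hρmin : 0 < ρmin) (hρ : ∀ s, ρmin ≤ M.ρ s)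
    -- bounded pseudo-rewards
    (U : ℝ) (hU : ∀ π ∈ PQA.policies S A, ∀ x, Γ π x ∈ Set.Icc 0 U)
    -- smoothness
    (L : ℝ) (hL : 0 < L) (hG : PQA.SmoothOnWith L (M.utility F) (PQA.policies S A))
    -- the iterates, numbered from `0` or from `1`
    (k₀ : ℕ) (hk₀ : k₀ ≤ 1)
    (π : ℕ → EuclideanSpace ℝ (S × A)) (hinit : π k₀ ∈ PQA.policies S A)
    (hstep : (∀ k ≥ k₀, M.IsProjStep (ρmin / L) (Γ (π k)) (π k) (π (k + 1))) ∨
      (∀ k ≥ k₀, M.IsArgmaxStep (ρmin / L) (Γ (π k)) (π k) (π (k + 1)))) :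
    ∃ πstar ∈ PQA.policies S A, IsMaxOn (M.utility F) (PQA.policies S A) πstar ∧
      ∀ K > k₀, M.utility F πstar - M.utility F (π K) ≤
        32 * L * (1 + 1 / ((1 - M.γ) * ρmin)) / ((1 - M.γ) ^ 2 * ρmin * K) := by
  obtain ⟨πstar, hstar, hmax⟩ :=
    PQA.isCompact_policies.exists_isMaxOn ⟨_, hinit⟩ hG.1.continuousOn
  refine ⟨πstar, hstar, hmax, ?_⟩
  have hmem : ∀ k ≥ k₀, π k ∈ PQA.policies S A := by
    intro k hk
    rcases hk.eq_or_lt with rfl | hk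
    · exact hinit
    obtain ⟨j, rfl⟩ := Nat.exists_eq_add_of_lt hk
    rcases hstep with h | h
    · exact fun s => (h (k₀ + j) (by omega) s).1
    · exact (h (k₀ + j) (by omega)).1
  have hargmax : ∀ k ≥ k₀, M.IsArgmaxStep (ρmin / L) (Γ (π k)) (π k) (π (k + 1)) := by
    rcases hstep with h | h
    · exact fun k hk => (h k hk).isArgmaxStep M (div_pos hρmin hL) (hmem k hk)
    · exact h
  have hγ : 0 < 1 - M.γ := sub_pos.2 M.γ_lt_one
  set c := (1 - M.γ) * ρmin with hc
  have hc0 : 0 < c := mul_pos hγ hρmin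
  -- A probability vector on `S` exists, so `S` is nonempty and `ρmin ≤ 1`.
  have hc1 : c ≤ 1 - M.γ := by
    obtain ⟨s⟩ : Nonempty S := by
      by_contra h
      rw [not_nonempty_iff] at h
      simpa using M.ρ_mem.2
    have hρ1 : M.ρ s ≤ 1 := (mem_Icc_of_mem_stdSimplex M.ρ_mem s).2
    exact mul_le_of_le_one_right hγ.le ((hρ s).trans hρ1)
  have hc1' : c ≤ 1 := hc1.trans (sub_le_self 1 M.γ_nonneg)
  set C := L / c ^ 2 with hC
  have hC0 : 0 < C := by positivity
  set δ : ℕ → ℝ := fun k => M.utility F πstar - M.utility F (π k) with hδ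
  have hδ0 : ∀ k ≥ k₀, 0 ≤ δ k := fun k hk => sub_nonneg.2 (hmax (hmem k hk))
  -- After one update the gap is at most `2 C c`, which is where the quadratic regime begins.
  have hfirst : ∀ k ≥ k₀ + 1, δ k ≤ 2 * C * c := by
    intro k hk
    obtain ⟨j, rfl⟩ := Nat.exists_eq_add_of_le' hk
    have hj : k₀ ≤ j + k₀ := by omega
    have h := PQA.MDP.IsArgmaxStep.utility_sub_le M hρmin hρ hL hG (hmem _ hj)
      (hΓ _ (hmem _ hj)) (hargmax _ hj) hstar
    refine h.trans_eq ?_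
    rw [← hc, hC]
    field_simp
  have hrec : ∀ k ≥ k₀ + 1, δ (k + 1) ≤ δ k - δ k ^ 2 / (4 * C) := by
    intro k hk
    have hk' : k ≥ k₀ := by omega
    -- `α = δ k / (2 C)` minimises `-α δ k + α ^ 2 C`.
    have h := PQA.MDP.IsArgmaxStep.utility_sub_le_recursion M hF hρmin hρ hL hG (hmem k hk')
      (hΓ _ (hmem k hk')) (hargmax k hk') hstar (α := δ k / (2 * C))
      (div_nonneg (hδ0 k hk') (by positivity))
      (by rw [div_le_iff₀ (by positivity)]; linarith [hfirst k hk])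
    refine h.trans_eq ?_
    change δ k - δ k / (2 * C) * δ k + (δ k / (2 * C)) ^ 2 * C = _
    field_simp
    ring
  intro K hK
  -- The base case needs `k₀ + 1 ≤ 2` and `c ≤ 1`.
  have hbase : δ (k₀ + 1) ≤ 8 * C / ((k₀ + 1 : ℕ) : ℝ) := by
    have hk2 : ((k₀ + 1 : ℕ) : ℝ) ≤ 2 := by exact_mod_cast Nat.succ_le_succ hk₀
    have : 2 * C * c ≤ 2 * C := mul_le_of_le_one_right (by positivity) hc1'
    rw [le_div_iff₀ (by positivity)]
    nlinarith [hfirst (k₀ + 1) le_rfl, hδ0 (k₀ + 1) (by omega)]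
  have hKpos : (0 : ℝ) < K := by exact_mod_cast (Nat.zero_le k₀).trans_lt hK
  have hmain : δ K ≤ 8 * C / K :=
    PQA.le_div_of_quadratic_decrease hC0 (by omega) hbase hrec hK
  refine hmain.trans ?_
  -- Since `c ≤ 1 - γ`, the constant `8 C = 8 L / c ^ 2` is below the stated one.
  have e : 32 * L * (1 + 1 / c) / ((1 - M.γ) ^ 2 * ρmin * K) =
      32 * L * (c + 1) / ((1 - M.γ) * c ^ 2 * K) := by
    rw [hc]
    field_simp
  rw [e, hC, le_div_iff₀ (by positivity)]
  have e2 : 8 * (L / c ^ 2) / K * ((1 - M.γ) * c ^ 2 * K) = 8 * L * (1 - M.γ) := by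
    field_simp
  rw [e2]
  nlinarith [mul_pos hL hc0, mul_nonneg hL.le M.γ_nonneg]
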